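/- Let $\Bbbk$ be an algebraically closed field of characteristic $0$, let $X=\mathrm{Spec}(R)$ be a normal affine variety over $\Bbbk$ and $x\in X$ a closed point. Let $\pi\colon Y\to X$ be a proper birational morphism from an integral scheme, let $E_1,\dots,E_m$ be distinct prime divisors on $Y$, put $E=E_1+\dots+E_m$, and let $\eta$ be the generic point of an irreducible component of $\bigcap_{i=1}^m E_i$. Assume that $(Y,E)$ is toroidal at $\eta$, i.e. $(\eta\in Y,E)\cong(\eta'\in Y',E'_1+\dots+E'_m)/G$ where $(Y',E'_1+\dots+E'_m)$ is a semi-local SNC pair and $G$ is a finite abelian group preserving each $E'_i$. Write $n_iE'_i$ for the pullback of $E_i$ and let $z_i$ be a local equation of $E'_i$. For $\alpha\in\mathbb{R}^m_{\ge 0}$ let $v_\alpha$ be the restriction to $K(X)$ of the quasi-monomial valuation at $\eta'$ giving weight $\alpha_i/n_i$ to $z_i$: if $f=\sum_\beta c_\beta z^\beta$ in $\widehat{\mathcal{O}}_{Y',\eta'}$ with every $c_\beta$ zero or a unit, then $$v_\alpha(f)=\min\Big\{\sum_i \tfrac{\alpha_i}{n_i}\beta_i \ \Big|\ c_\beta\ne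 0\Big\}.$$ Thus $v_\alpha(E_i)=\alpha_i$. Let $\mathrm{QM}_\eta(Y,E)=\{v_\alpha\mid\alpha\in\mathbb{R}^m_{\ge 0}\}$. Let $v_1,\dots,v_r\in\mathrm{QM}_\eta(Y,E)$ be divisorial valuations (positive real multiples of $\mathrm{ord}_F$ for prime divisors $F$ over $X$) centered at $x$, say $v_i=v_{\alpha^{(i)}}$. For $s=(s_1,\dots,s_r)\in\mathbb{R}^r_{\ge 0}\setminus\{0\}$ let $v_s=v_{s_1\alpha^{(1)}+\dots+s_r\alpha^{(r)}}$, and for $\lambda\in\mathbb{R}$ let $$\mathfrak{a}_\lambda(v_s)=\{f\in R\mid v_s(f)\ge\lambda\},\qquad I_{s,\lambda}=\mathrm{Span}\{f\in R\mid s_1v_1(f)+\dots+s_rv_r(f)\ge\lambda\}\subseteq R .$$ If $\mathfrak{a}_\lambda(v_s)=I_{s,\lambda}$ for all $\lambda\in\mathbb{R}$ and all $s\in\mathbb{Q}^r_{\ge 0}\setminus\{0\}$, then $\mathfrak{a}_\lambda(v_s)=I_{s,\lambda}$ for all $\lambda\in\mathbb{R}$ and all $s\in\mathbb{R}^r_{\ge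 0}\setminus\{0\}$. -/

import Mathlib

open AlgebraicGeometry CategoryTheory
open scoped NNReal ENNReal

universe u

noncomputable section

/-! ### Birational morphisms and divisorial valuations -/

/-- A morphism is birational if it is an isomorphism over some nonempty open subset of the target.
(It is only used for morphisms between integral schemes, where nonempty open sets are dense.) -/
def IsBirationalMorphism {Y X : Scheme.{u}} (π : Y ⟶ X) : Prop :=
  ∃ U : X.Opens, (U : Set X).Nonempty ∧ IsIso (π ∣_ U)

/-- The homomorphism `R → 𝒪_{Y,y}` attached to a morphism `π : Y ⟶ Spec R` and a point `y` of `Y`.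
-/
def toStalk {R : Type u} [CommRing R] {Y : Scheme.{u}} (π : Y ⟶ Spec (.of R)) (y : Y) :
    R →+* Y.presheaf.stalk y :=
  ((Scheme.ΓSpecIso (.of R)).inv ≫ π.appTop ≫ Y.presheaf.germ ⊤ y trivial).hom

/-- A function `v` on `R` (standing for a valuation of `Frac R` that is nonnegative on `R`) is
divisorial if `v = c · ord_F` for some real `c > 0` and some prime divisor `F` on a normal integral
scheme `W` with a proper birational morphism to `Spec R`. The prime divisor `F` is given by its
generic point `ξ`, a point of codimension one, and `ord_F` is the order in the discrete valuation
ring `𝒪_{W,ξ}`. -/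
def IsDivisorial {R : Type u} [CommRing R] (v : R → ℝ≥0∞) : Prop :=
  ∃ (W : Scheme.{u}) (_ : IsIntegral W) (μ : W ⟶ Spec (.of R)) (ξ : W) (c : ℝ≥0),
    (∀ w : W, IsIntegrallyClosed (W.presheaf.stalk w)) ∧
    IsProper μ ∧ IsBirationalMorphism μ ∧ Order.coheight ξ = 1 ∧ 0 < c ∧
    ∀ f : R, v f = (c : ℝ≥0∞) * (Ring.ord (W.presheaf.stalk ξ) (toStalk μ ξ f) : ℝ≥0∞)

/-! ### Toroidal points and quasi-monomial valuations -/

/-- If `e` specializes to `η`, the prime ideal of the local ring `𝒪_{Y,η}` that defines the closure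
of `e`. -/
def specializationIdeal {Y : Scheme.{u}} {e η : Y} (h : e ⤳ η) : Ideal (Y.presheaf.stalk η) :=
  (IsLocalRing.maximalIdeal (Y.presheaf.stalk e)).comap (Y.presheaf.stalkSpecializes h).hom

/-- A presentation of `(Y, E₁ + ⋯ + E_m)` at `η` as the quotient of a semi-local SNC pair
`(Spec B, E'₁ + ⋯ + E'_m)` by a finite abelian group `G` that preserves every `E'_i`. Here `E_i` is
the closure of `e i`, the divisor `E'_i` is `(z i = 0)`, and `η` is a generic point of
`E₁ ∩ ⋯ ∩ E_m`, so that `z` is a full regular system of parameters at every closed point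
of `Spec B`. The case of an SNC pair is `G = 1`. -/
structure ToroidalChart {Y : Scheme.{u}} (η : Y) {m : ℕ} (e : Fin m → Y)
    (he : ∀ i, e i ⤳ η) where
  /-- The semi-local ring upstairs. -/
  B : Type u
  [commRing : CommRing B]
  [isDomain : IsDomain B]
  [isNoetherianRing : IsNoetherianRing B]
  /-- The quotient map, as the inclusion of the local ring at `η`. -/
  [algebra : Algebra (Y.presheaf.stalk η) B]
  /-- The finite abelian group. -/
  G : Type u
  [commGroup : CommGroup G]
  [finite : Finite G]
  [action : MulSemiringAction G B]
  /-- The group acts by automorphisms over `𝒪_{Y,η}`. -/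
  [smulCommClass : SMulCommClass G (Y.presheaf.stalk η) B]
  /-- Every invariant comes from `𝒪_{Y,η}`. -/
  isInvariant : Algebra.IsInvariant (Y.presheaf.stalk η) B G
  injective : Function.Injective (algebraMap (Y.presheaf.stalk η) B)
  semilocal : {n : Ideal B | n.IsMaximal}.Finite
  /-- Equations of the components `E'_i`. -/
  z : Fin m → B
  prime_z : ∀ i, Prime (z i)
  /-- The group preserves every component. -/
  smul_z : ∀ (g : G) (i : Fin m), Associated (g • z i) (z i)
  /-- The `z i` generate the maximal ideal of `B_n`, and `B_n` has dimension `m`. -/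
  regular : ∀ (n : Ideal B) [n.IsMaximal],
    Ideal.span (Set.range fun i => algebraMap B (Localization.AtPrime n) (z i)) =
      IsLocalRing.maximalIdeal (Localization.AtPrime n) ∧ n.height = m
  /-- The image of `E'_i` is `E_i`. -/
  under_z : ∀ i, (Ideal.span {z i}).under (Y.presheaf.stalk η) = specializationIdeal (he i)
  /-- A closed point `η'` of `Spec B`. -/
  pt : Ideal B
  isMaximal_pt : pt.IsMaximal

attribute [instance] ToroidalChart.commRing ToroidalChart.isDomain ToroidalChart.isNoetherianRing
  ToroidalChart.algebra ToroidalChart.commGroup ToroidalChart.finite ToroidalChart.action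
  ToroidalChart.smulCommClass ToroidalChart.isMaximal_pt

namespace ToroidalChart

variable {Y : Scheme.{u}} {η : Y} {m : ℕ} {e : Fin m → Y} {he : ∀ i, e i ⤳ η}
  (T : ToroidalChart η e he)

/-- `c` is the family of coefficients of an expansion `f = ∑ c_β z^β` in the completed local ring
at the point `η'`, in which every coefficient is zero or a unit. (The completion of `B` along a
maximal ideal is the completion of the local ring there, and the equality is tested modulo every
power of the maximal ideal; the monomials of degree at least `N` vanish modulo the `N`-th power.)
-/
def IsExpansion (f : T.B) (c : (Fin m → ℕ) → AdicCompletion T.pt T.B) : Prop :=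
  (∀ β, c β = 0 ∨ IsUnit (c β)) ∧
  ∀ N : ℕ, Ideal.Quotient.mk (T.pt ^ N) f =
    ∑ d ∈ Finset.range N, ∑ β ∈ Finset.Nat.antidiagonalTuple m d,
      AdicCompletion.evalₐ T.pt N (c β) * Ideal.Quotient.mk (T.pt ^ N) (∏ i, T.z i ^ β i)

/-- The multiplicity `n_i` in the pullback `n_i E'_i` of `E_i`. -/
def mult (i : Fin m) : ℕ := (Ideal.span {T.z i}).ramificationIdx (Y.presheaf.stalk η)

/-- The weight of `z^β`, where `z i` has weight `α i / n_i`, so that `E_i` has weight `α i`. -/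
def weight (α : Fin m → ℝ≥0) (β : Fin m → ℕ) : ℝ≥0 := ∑ i, α i / (T.mult i : ℝ≥0) * (β i : ℝ≥0)

/-- The quasi-monomial valuation `v_α` on `𝒪_{Y,η}`: the least weight of a monomial with nonzero
coefficient in an expansion of `f`. It does not depend on the expansion; the supremum over all
expansions serves to pick this common value, and `v_α 0 = ⊤`. -/
def qm (α : Fin m → ℝ≥0) (f : Y.presheaf.stalk η) : ℝ≥0∞ :=
  ⨆ (c : (Fin m → ℕ) → AdicCompletion T.pt T.B)
    (_ : T.IsExpansion (algebraMap (Y.presheaf.stalk η) T.B f) c),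
    ⨅ (β : Fin m → ℕ) (_ : c β ≠ 0), (T.weight α β : ℝ≥0∞)

end ToroidalChart

/-- The valuation `v_α` restricted to `R`, for `π : Y ⟶ Spec R`. -/
def qmOn {R : Type u} [CommRing R] {Y : Scheme.{u}} (π : Y ⟶ Spec (.of R)) {η : Y} {m : ℕ}
    {e : Fin m → Y} {he : ∀ i, e i ⤳ η} (T : ToroidalChart η e he) (α : Fin m → ℝ≥0)
    (f : R) : ℝ≥0∞ :=
  T.qm α (toStalk π η f)

/-- The image `∑ i, s i • a i` of `s` under the linear map of weights sending the `i`-th basis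
vector to `a i`. -/
def combine {r m : ℕ} (a : Fin r → Fin m → ℝ≥0) (s : Fin r → ℝ≥0) : Fin m → ℝ≥0 :=
  fun j => ∑ i, s i * a i j

/-- The elements `f` of `R` with `v f ≥ t`. -/
def valuationIdeal {R : Type u} (v : R → ℝ≥0∞) (t : ℝ) : Set R :=
  {f | ENNReal.ofReal t ≤ v f}

/-- The ideal `I_{s,t}` spanned by the `f` in `R` with `s₁ v₁(f) + ⋯ + s_r v_r(f) ≥ t`. -/
def spanIdeal {R : Type u} [CommRing R] {r : ℕ} (v : Fin r → R → ℝ≥0∞) (s : Fin r → ℝ≥0)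
    (t : ℝ) : Ideal R :=
  Ideal.span {f | ENNReal.ofReal t ≤ ∑ i, (s i : ℝ≥0∞) * v i f}

end

/-!
Membership of `f` in `𝔞_t(v_s)` and in `I_{s,t}` is compared for a real weight vector `s` and for
rational vectors `q` squeezed between multiples of `s`. Two facts about the valuations are used: the
value `v_s(f)`, a minimum of linear forms in `s` with nonnegative coefficients, is monotone in `s`
(`qmOn_mono`), and each `v_i`, being divisorial, takes values in `c_i ℕ ∪ {∞}`.

For `I_{s,t} ⊆ 𝔞_t(v_s)`, let `δ < 1` and choose `q` rational with `δ s ≤ q ≤ s`. Then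
`I_{s,t} ⊆ I_{q,δt} = 𝔞_{δt}(v_q) ⊆ 𝔞_{δt}(v_s)`, and `δ` tends to `1`.

For `𝔞_t(v_s) ⊆ I_{s,t}`, only finitely many values `∑ s_i v_i(g)` are smaller than `t`
(`finite_sum_mul_natCast_lt`), so for some `l > 1` even `l ∑ s_i v_i(g) < t` for all such `g`. If `q`
is rational with `s ≤ q ≤ l s`, then `∑ q_i v_i(g) ≥ t` forces `∑ s_i v_i(g) ≥ t`, whence
`𝔞_t(v_s) ⊆ 𝔞_t(v_q) = I_{q,t} ⊆ I_{s,t}`.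
-/

/-! ### Monotonicity in the weights -/

namespace ToroidalChart

variable {Y : Scheme.{u}} {η : Y} {m : ℕ} {e : Fin m → Y} {he : ∀ i, e i ⤳ η}
  (T : ToroidalChart η e he)

lemma weight_mono {α α' : Fin m → ℝ≥0} (h : α ≤ α') (β : Fin m → ℕ) :
    T.weight α β ≤ T.weight α' β := by
  unfold weight
  gcongr with i
  exact h i

lemma qm_mono {α α' : Fin m → ℝ≥0} (h : α ≤ α') (f : Y.presheaf.stalk η) :
    T.qm α f ≤ T.qm α' f :=
  iSup₂_mono fun _ _ ↦ iInf₂_mono fun β _ ↦ ENNReal.coe_le_coe.2 (T.weight_mono h β)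

end ToroidalChart

lemma qmOn_mono {R : Type u} [CommRing R] {Y : Scheme.{u}} (π : Y ⟶ Spec (.of R)) {η : Y} {m : ℕ}
    {e : Fin m → Y} {he : ∀ i, e i ⤳ η} (T : ToroidalChart η e he) {α α' : Fin m → ℝ≥0}
    (h : α ≤ α') (f : R) : qmOn π T α f ≤ qmOn π T α' f :=
  T.qm_mono h _

lemma combine_mono {r m : ℕ} (a : Fin r → Fin m → ℝ≥0) : Monotone (combine a) := by
  intro s s' h j
  unfold combine
  gcongr with i
  exact h i

/-! ### Rational approximation and discreteness -/

/-- The vanishing coordinates of `s` are kept: `q i = 0` wherever `s i = 0`. -/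
lemma exists_nnrat_between_smul {ι : Type*} (s : ι → ℝ≥0) {δ l : ℝ≥0} (h : δ < l) :
    ∃ q : ι → ℚ≥0, ∀ i, δ * s i ≤ (q i : ℝ≥0) ∧ (q i : ℝ≥0) ≤ l * s i := by
  have (i : ι) : ∃ q : ℚ≥0, δ * s i ≤ (q : ℝ≥0) ∧ (q : ℝ≥0) ≤ l * s i := by
    rcases eq_or_ne (s i) 0 with h0 | h0
    · exact ⟨0, by simp [h0]⟩
    · obtain ⟨q, h₁, h₂⟩ := exists_rat_btwn (K := ℝ) (NNReal.coe_lt_coe.2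
        (mul_lt_mul_of_pos_right h (pos_iff_ne_zero.2 h0)))
      have hq : 0 ≤ q := by exact_mod_cast (NNReal.coe_nonneg _).trans h₁.le
      lift q to ℚ≥0 using hq
      exact ⟨q, by exact_mod_cast h₁.le, by exact_mod_cast h₂.le⟩
  choose q hq using this
  exact ⟨q, hq⟩

lemma finite_sum_mul_natCast_lt {ι : Type*} [Fintype ι] (y : ι → ℝ≥0) {b : ℝ≥0∞} (hb : b ≠ ⊤) :
    {x | x < b ∧ ∃ n : ι → ℕ∞, x = ∑ i, (y i : ℝ≥0∞) * (n i : ℝ≥0∞)}.Finite := by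
  have (i : ι) : ∃ N : ℕ, y i ≠ 0 → b < y i * N := by
    by_cases hy : y i = 0
    · exact ⟨0, fun h ↦ absurd hy h⟩
    · obtain ⟨N, hN⟩ := ENNReal.exists_nat_mul_gt (a := (y i : ℝ≥0∞)) (by simpa using hy) hb
      exact ⟨N, fun _ ↦ by rwa [mul_comm]⟩
  choose N hN using this
  refine ((Set.Finite.pi' fun i ↦ Set.finite_Iic (N i)).image
    fun n : ι → ℕ ↦ ∑ i, (y i : ℝ≥0∞) * (n i : ℝ≥0∞)).subset ?_
  rintro x ⟨hx, n, rfl⟩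
  have hlt (i : ι) (hy : y i ≠ 0) : n i < N i := by
    by_contra! h
    refine (hN i hy).not_ge (le_trans ?_ hx.le)
    refine le_trans ?_ (Finset.single_le_sum (fun _ _ ↦ zero_le) (Finset.mem_univ i))
    gcongr
    exact_mod_cast h
  -- Where `y i = 0` the coefficient `n i` is unbounded, possibly infinite, but irrelevant.
  refine ⟨fun i ↦ if y i = 0 then 0 else (n i).toNat, fun i ↦ ?_, ?_⟩
  · by_cases hy : y i = 0
    · simp [hy]
    · simpa [hy] using ENat.toNat_le_of_le_natCast (hlt i hy).le
  · refine Finset.sum_congr rfl fun i _ ↦ ?_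
    by_cases hy : y i = 0
    · simp [hy]
    · have h : ((n i).toNat : ℕ∞) = n i := ENat.natCast_toNat (hlt i hy).ne_top
      simp only [hy, if_false]
      rw [← h]
      simp

lemma exists_one_lt_forall_mul_lt {S : Set ℝ≥0∞} (hS : S.Finite) {b : ℝ≥0∞}
    (h : ∀ x ∈ S, x < b) : ∃ l : ℝ≥0, 1 < l ∧ ∀ x ∈ S, (l : ℝ≥0∞) * x < b := by
  have hev : ∀ᶠ l : ℝ≥0 in nhds 1, ∀ x ∈ S, (l : ℝ≥0∞) * x < b := by
    refine (Filter.eventually_all_finite hS).2 fun x hx ↦ ?_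
    have ht : Filter.Tendsto (fun l : ℝ≥0 ↦ (l : ℝ≥0∞) * x) (nhds 1) (nhds (1 * x)) :=
      ENNReal.Tendsto.mul_const (ENNReal.tendsto_coe.2 Filter.tendsto_id) (by simp)
    exact ht.eventually_lt_const (by simpa using h x hx)
  obtain ⟨l, hl, hl₁⟩ := ((hev.filter_mono nhdsWithin_le_nhds).and
    (self_mem_nhdsWithin : Set.Ioi (1 : ℝ≥0) ∈ nhdsWithin 1 (Set.Ioi 1))).exists
  exact ⟨l, hl₁, hl⟩

/-! ### From rational to real weights -/

/-- The lower bound `w s f ≥ t` on the span passes to real `s` by rational approximation of `s` from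
below. -/
lemma spanIdeal_subset_valuationIdeal_of_rational {R : Type u} [CommRing R] {r : ℕ}
    (v : Fin r → R → ℝ≥0∞) (w : (Fin r → ℝ≥0) → R → ℝ≥0∞) (hw : ∀ f, Monotone fun s ↦ w s f)
    (hrat : ∀ q : Fin r → ℚ≥0, q ≠ 0 → ∀ t : ℝ,
      (spanIdeal v (fun i ↦ (q i : ℝ≥0)) t : Set R) ⊆
        valuationIdeal (w fun i ↦ (q i : ℝ≥0)) t)
    {s : Fin r → ℝ≥0} (hs : s ≠ 0) (t : ℝ) :
    (spanIdeal v s t : Set R) ⊆ valuationIdeal (w s) t := by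
  intro f hf
  have key (δ : ℝ≥0) (hδ₀ : 0 < δ) (hδ : δ < 1) : (δ : ℝ≥0∞) * ENNReal.ofReal t ≤ w s f := by
    obtain ⟨q, hq⟩ := exists_nnrat_between_smul s hδ
    have hq₀ : q ≠ 0 := by
      rintro rfl
      refine hs (funext fun i ↦ ?_)
      simpa [hδ₀.ne'] using (hq i).1
    have hδt : ENNReal.ofReal (δ * t) = (δ : ℝ≥0∞) * ENNReal.ofReal t := by
      rw [ENNReal.ofReal_mul δ.coe_nonneg, ENNReal.ofReal_coe_nnreal]
    have hmem : f ∈ spanIdeal v (fun i ↦ (q i : ℝ≥0)) (δ * t) := by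
      refine Ideal.span_mono (fun g hg ↦ ?_) hf
      simp only [Set.mem_ofPred_eq] at hg ⊢
      calc ENNReal.ofReal (δ * t) = δ * ENNReal.ofReal t := hδt
        _ ≤ δ * ∑ i, (s i : ℝ≥0∞) * v i g := by gcongr
        _ = ∑ i, ((δ * s i : ℝ≥0) : ℝ≥0∞) * v i g := by
          simp [Finset.mul_sum, mul_assoc]
        _ ≤ ∑ i, ((q i : ℝ≥0) : ℝ≥0∞) * v i g := by
          gcongr with i
          exact (hq i).1
    rw [← hδt]
    exact (hrat q hq₀ _ hmem).trans (hw f fun i ↦ by simpa using (hq i).2)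
  have ht : Filter.Tendsto (fun δ : ℝ≥0 ↦ (δ : ℝ≥0∞) * ENNReal.ofReal t)
      (nhdsWithin 1 (Set.Iio 1)) (nhds (1 * ENNReal.ofReal t)) :=
    (ENNReal.Tendsto.mul_const (ENNReal.tendsto_coe.2 Filter.tendsto_id) (by simp)).mono_left
      nhdsWithin_le_nhds
  rw [one_mul] at ht
  have : (nhdsWithin (1 : ℝ≥0) (Set.Iio 1)).NeBot := nhdsLT_neBot_of_exists_lt ⟨0, one_pos⟩
  refine le_of_tendsto ht ?_
  filter_upwards [self_mem_nhdsWithin, nhdsWithin_le_nhds (lt_mem_nhds one_pos)] with δ h₁ h₀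
  exact key δ h₀ h₁

/-- Discreteness of the values of the `v i` makes `I_{q,t} ⊆ I_{s,t}` for all `q ≥ s` close enough
to `s`. -/
lemma valuationIdeal_subset_spanIdeal_of_rational {R : Type u} [CommRing R] {r : ℕ}
    (v : Fin r → R → ℝ≥0∞) (w : (Fin r → ℝ≥0) → R → ℝ≥0∞) (hw : ∀ f, Monotone fun s ↦ w s f)
    (hv : ∀ i, ∃ c : ℝ≥0, ∀ f, ∃ n : ℕ∞, v i f = (c : ℝ≥0∞) * (n : ℝ≥0∞))
    (hrat : ∀ q : Fin r → ℚ≥0, q ≠ 0 → ∀ t : ℝ,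
      valuationIdeal (w fun i ↦ (q i : ℝ≥0)) t ⊆
        (spanIdeal v (fun i ↦ (q i : ℝ≥0)) t : Set R))
    {s : Fin r → ℝ≥0} (hs : s ≠ 0) (t : ℝ) :
    valuationIdeal (w s) t ⊆ (spanIdeal v s t : Set R) := by
  choose c n hn using hv
  obtain ⟨l, hl₁, hl⟩ := exists_one_lt_forall_mul_lt
    (finite_sum_mul_natCast_lt (fun i ↦ s i * c i) (b := ENNReal.ofReal t) ENNReal.ofReal_ne_top)
    fun x hx ↦ hx.1
  obtain ⟨q, hq⟩ := exists_nnrat_between_smul s hl₁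
  have hsq : s ≤ fun i ↦ (q i : ℝ≥0) := fun i ↦ by simpa using (hq i).1
  have hq₀ : q ≠ 0 := by
    rintro rfl
    exact hs (funext fun i ↦ by simpa using hsq i)
  intro f hf
  refine Ideal.span_mono (fun g hg ↦ ?_) (hrat q hq₀ t (le_trans hf (hw f hsq)))
  simp only [Set.mem_ofPred_eq] at hg ⊢
  by_contra! hlt
  refine (hl _ ⟨hlt, fun i ↦ n i g, ?_⟩).not_ge (hg.trans ?_)
  · simp [hn, mul_assoc]
  · rw [Finset.mul_sum]
    refine Finset.sum_le_sum fun i _ ↦ ?_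
    rw [← mul_assoc, ← ENNReal.coe_mul]
    gcongr
    exact (hq i).2

/-- Let `w s` be a family of functions on `R`, monotone in `s`, and let each `v i` have values in
`c ℕ ∪ {∞}` for some `c`. The equality of `{f | w s f ≥ t}` and `I_{s,t}` for rational `s` implies
it for real `s`. -/
theorem valuationIdeal_eq_spanIdeal_of_rational {R : Type u} [CommRing R] {r : ℕ}
    (v : Fin r → R → ℝ≥0∞) (w : (Fin r → ℝ≥0) → R → ℝ≥0∞) (hw : ∀ f, Monotone fun s ↦ w s f)
    (hv : ∀ i, ∃ c : ℝ≥0, ∀ f, ∃ n : ℕ∞, v i f = (c : ℝ≥0∞) * (n : ℝ≥0∞))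
    (hrat : ∀ q : Fin r → ℚ≥0, q ≠ 0 → ∀ t : ℝ,
      valuationIdeal (w fun i ↦ (q i : ℝ≥0)) t =
        (spanIdeal v (fun i ↦ (q i : ℝ≥0)) t : Set R))
    {s : Fin r → ℝ≥0} (hs : s ≠ 0) (t : ℝ) :
    valuationIdeal (w s) t = (spanIdeal v s t : Set R) :=
  (valuationIdeal_subset_spanIdeal_of_rational v w hw hv
    (fun q hq t ↦ (hrat q hq t).subset) hs t).antisymm
  (spanIdeal_subset_valuationIdeal_of_rational v w hw
    (fun q hq t ↦ (hrat q hq t).superset) hs t)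

theorem mainTheorem12 {k : Type*} [Field k] [IsAlgClosed k] [CharZero k]
    {R : Type u} [CommRing R] [IsDomain R] [IsIntegrallyClosed R] [Algebra k R]
    [Algebra.FiniteType k R] (x : Ideal R) (_hx : x.IsMaximal)
    (Y : Scheme.{u}) [IsIntegral Y] (π : Y ⟶ Spec (.of R)) [IsProper π]
    (_hπ : IsBirationalMorphism π)
    {m : ℕ} (e : Fin m → Y) (_he_inj : Function.Injective e)
    (_he_codim : ∀ i, Order.coheight (e i) = 1)
    (η : Y) (hη : ∀ i, e i ⤳ η)
    (_hη_generic : ∀ y : Y, (∀ i, e i ⤳ y) → y ⤳ η → y = η)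
    (T : ToroidalChart η e hη)
    {r : ℕ} (a : Fin r → Fin m → ℝ≥0)
    (_hdiv : ∀ i, IsDivisorial (qmOn π T (a i)))
    (_hcenter : ∀ i, ∀ f ∈ x, 0 < qmOn π T (a i) f)
    (hrat : ∀ q : Fin r → ℚ≥0, q ≠ 0 → ∀ t : ℝ,
      valuationIdeal (qmOn π T (combine a fun i => (q i : ℝ≥0))) t =
        (spanIdeal (fun i => qmOn π T (a i)) (fun i => (q i : ℝ≥0)) t : Set R)) :
    ∀ s : Fin r → ℝ≥0, s ≠ 0 → ∀ t : ℝ,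
      valuationIdeal (qmOn π T (combine a s)) t =
        (spanIdeal (fun i => qmOn π T (a i)) s t : Set R) := by
  intro s hs t
  refine valuationIdeal_eq_spanIdeal_of_rational (fun i ↦ qmOn π T (a i))
    (fun s ↦ qmOn π T (combine a s)) (fun f _ _ h ↦ qmOn_mono π T (combine_mono a h) f)
    (fun i ↦ ?_) hrat hs t
  obtain ⟨W, _, μ, ξ, c, -, -, -, -, -, h⟩ := _hdiv i
  exact ⟨c, fun f ↦ ⟨_, h f⟩⟩
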